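/- Let $n$ and $k$ be integers with $n \geq 2k$ and $k \geq 3$, and let $c$ and $r$ be the unique integers such that $n = ck + r$ and $0 \leq r \leq k-1$. Suppose that $r \neq 0$ and that $n$ and $ck$ are both even. Let $u \in \{1, \ldots, \lfloor c/2 \rfloor\}$, where $u = c/2$ if $r = k-1$, and put \[ a(u) = \sum_{i=u}^{c-u} \binom{n/2}{i}\binom{n/2}{c-i}, \qquad b(u) = 2\sum_{i=0}^{u-1} \binom{n/2}{i}\binom{n/2}{c+1-i}. \] Then there is an almost uniform $(n,k)$-Sperner partition system with exactly \[ p = \min\left( \left\lfloor \frac{a(u)}{k-r} \right\rfloor, \left\lfloor \frac{b(u)}{r} \right\rfloor \right) \] partitions. Here an $(n,k)$-Sperner partition system is a set of partitions of some $n$-set, each into $k$ nonempty classes, such that no class of any partition is a subset of a class of any other partition in the set. It is almost uniform if every class of every partition in it has cardinality $\lfloor n/k \rfloor$ or $\lceil n/k \rceil$. -/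

import Mathlib

namespace SpernerPartition

/-- A finite set `P` of partitions of the finite ground set `α` is an `(n, k)`-Sperner partition
system if `α` has `n` elements, each partition in `P` has exactly `k` classes (the parts of a
`Finpartition` are nonempty), and no class of a partition in `P` is a subset of a class of
another partition in `P`. -/
structure IsSpernerPartitionSystem {α : Type*} [Fintype α] [DecidableEq α] (n k : ℕ)
    (P : Finset (Finpartition (Finset.univ : Finset α))) : Prop where
  card_ground : Fintype.card α = n
  card_classes : ∀ π ∈ P, π.parts.card = k
  sperner : ∀ π ∈ P, ∀ ρ ∈ P, π ≠ ρ → ∀ A ∈ π.parts, ∀ B ∈ ρ.parts, ¬ A ⊆ B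

/-- Each class of each partition has `⌊n / k⌋` or `⌈n / k⌉` elements. -/
def IsAlmostUniform {α : Type*} [Fintype α] [DecidableEq α] (n k : ℕ)
    (P : Finset (Finpartition (Finset.univ : Finset α))) : Prop :=
  ∀ π ∈ P, ∀ A ∈ π.parts, A.card = n / k ∨ A.card = n ⌈/⌉ k

/-- `a(u) = ∑_{i = u}^{c - u} C(n/2, i) C(n/2, c - i)` -/
def a (n c u : ℕ) : ℕ :=
  ∑ i ∈ Finset.Icc u (c - u), (n / 2).choose i * (n / 2).choose (c - i)

/-- `b(u) = 2 ∑_{i = 0}^{u - 1} C(n/2, i) C(n/2, c + 1 - i)` -/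
def b (n c u : ℕ) : ℕ :=
  2 * ∑ i ∈ Finset.range u, (n / 2).choose i * (n / 2).choose (c + 1 - i)

end SpernerPartition

namespace SpernerPartition

open Finset

/-! Split the ground set into two halves of size `m = n / 2`. Use as classes the `c`-sets that meet
both halves in at least `u` points and the `(c + 1)`-sets that meet one half in fewer than `u`
points. There are `a(u)` and `b(u)` of these, and they form an antichain, since a `c`-set of the
family has too many points in the half that a larger set nearly misses (`not_subset_of_admissible`).

It remains to form `p` disjoint groups of `k - r` small and `r` large sets that are partitions. By
the recolouring theorem `exists_almost_regular_colouring`, only the sizes of the intersections with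
the halves matter: if those of a group add up to `m` on each half, then almost regularity makes
every point degree equal to 1 (`exists_partition_colouring`).

This leaves a packing problem for integers. Record a set by its number of points in the first half.
It suffices that in each group the small sets have mean `c / 2` and the large sets have mean `(c +
1) / 2`. The available multisets are symmetric about these means. Since `r` is even, the large sets
can be taken in symmetric pairs, and so can the small ones when `k - r` is even. If `k - r` is odd,
then `c` is even. Either `k - r = 1` and all small sets are balanced, or each group needs one triple
besides its pairs. The triples come from `packs_triples_pairs_unimodal`, which applies because the
products of binomial coefficients are unimodal with a pronounced peak (`splitCount_gap`). -/

/-! ### Balanced orientations of multigraphs. -/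

/-- The incidence vector of an oriented edge. -/
def IsEdgeVector {K : Type*} [DecidableEq K] (w : K → ℤ) : Prop :=
  ∃ a b : K, ∀ κ, w κ = (if a = κ then 1 else 0) - (if b = κ then 1 else 0)

/-- Two edges meeting at `κ` can be spliced into a single edge through `κ`; `σ` reverses the second
edge when needed so that the contributions at `κ` cancel. -/
lemma IsEdgeVector.exists_add {K : Type*} [DecidableEq K] {w w' : K → ℤ}
    (hw : IsEdgeVector w) (hw' : IsEdgeVector w') {κ : K} (h : w κ ≠ 0) (h' : w' κ ≠ 0) :
    ∃ σ : ℤ, (σ = 1 ∨ σ = -1) ∧ IsEdgeVector (fun κ => w κ + σ * w' κ) := by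
  obtain ⟨a, b, hab⟩ := hw
  obtain ⟨a', b', hab'⟩ := hw'
  rw [hab] at h
  rw [hab'] at h'
  by_cases h1 : a = κ
  · by_cases h2 : a' = κ
    · exact ⟨-1, Or.inr rfl, b', b, fun x => by simp only [hab, hab', h1, h2]; ring⟩
    · have h3 : b' = κ := by by_contra h3; simp [h2, h3] at h'
      exact ⟨1, Or.inl rfl, a', b, fun x => by simp only [hab, hab', h1, h3]; ring⟩
  · have h3 : b = κ := by by_contra h3; simp [h1, h3] at h
    by_cases h2 : a' = κ
    · exact ⟨1, Or.inl rfl, a, b', fun x => by simp only [hab, hab', h3, h2]; ring⟩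
    · have h4 : b' = κ := by by_contra h4; simp [h2, h4] at h'
      exact ⟨-1, Or.inr rfl, a, a', fun x => by simp only [hab, hab', h3, h4]; ring⟩

lemma IsEdgeVector.abs_le {K : Type*} [DecidableEq K] {w : K → ℤ} (hw : IsEdgeVector w) (κ : K) :
    |w κ| ≤ 1 := by
  obtain ⟨a, b, hab⟩ := hw
  rw [hab]
  split_ifs <;> simp

/-- Every finite multigraph has an orientation in which in- and outdegrees differ by at most one. -/
lemma exists_balanced_orientation {ι K : Type*} [DecidableEq ι] [DecidableEq K] (I : Finset ι)
    (w : ι → K → ℤ) (hw : ∀ i ∈ I, IsEdgeVector (w i)) :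
    ∃ ε : ι → ℤ, (∀ i, ε i = 1 ∨ ε i = -1) ∧ ∀ κ, |∑ i ∈ I, ε i * w i κ| ≤ 1 := by
  induction hn : I.card generalizing I w with
  | zero =>
    rw [card_eq_zero] at hn
    exact ⟨fun _ => 1, fun _ => Or.inl rfl, fun κ => by simp [hn]⟩
  | succ n ih =>
    by_cases hE : ∃ i ∈ I, ∃ j ∈ I, i ≠ j ∧ ∃ κ, w i κ ≠ 0 ∧ w j κ ≠ 0
    · obtain ⟨i, hi, j, hj, hij, κ, h1, h2⟩ := hE
      obtain ⟨σ, hσ, hadd⟩ := (hw i hi).exists_add (hw j hj) h1 h2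
      have hiI : i ∈ I.erase j := mem_erase.2 ⟨hij, hi⟩
      obtain ⟨ε, hε, hsum⟩ := ih (I.erase j)
        (Function.update w i fun κ => w i κ + σ * w j κ) (by
          intro l hl
          by_cases hli : l = i
          · subst hli; simpa using hadd
          · rw [Function.update_of_ne hli]; exact hw l (mem_of_mem_erase hl))
        (by rw [card_erase_of_mem hj, hn]; rfl)
      -- Undo the splicing: edge `j` gets the direction in which the spliced edge traverses it.
      refine ⟨Function.update ε j (ε i * σ), fun l => ?_, fun x => ?_⟩
      · by_cases hl : l = j
        · subst hl
          rcases hε i with h | h <;> rcases hσ with h' | h' <;> simp [h, h']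
        · rw [Function.update_of_ne hl]; exact hε l
      · have key : ∑ l ∈ I, Function.update ε j (ε i * σ) l * w l x
            = ∑ l ∈ I.erase j, ε l * Function.update w i (fun κ => w i κ + σ * w j κ) l x := by
          rw [← add_sum_erase I _ hj, ← add_sum_erase (I.erase j) _ hiI,
            ← add_sum_erase (I.erase j) _ hiI, ← add_assoc]
          congr 1
          · rw [Function.update_self, Function.update_self, Function.update_of_ne hij]; ring
          · refine sum_congr rfl fun l hl => ?_
            have hl1 : l ≠ i := ne_of_mem_erase hl
            have hl2 : l ≠ j := ne_of_mem_erase (mem_of_mem_erase hl)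
            rw [Function.update_of_ne hl1, Function.update_of_ne hl2]
        rw [key]; exact hsum x
    · push Not at hE
      -- Now at most one edge contributes at each vertex, so any orientation is balanced.
      refine ⟨fun _ => 1, fun _ => Or.inl rfl, fun κ => ?_⟩
      by_cases h : ∃ i ∈ I, w i κ ≠ 0
      · obtain ⟨i, hi, hne⟩ := h
        rw [sum_eq_single_of_mem i hi fun j hj hji => by
          rw [hE i hi j hj hji.symm κ hne, mul_zero]]
        simpa using (hw i hi).abs_le κ
      · push Not at h
        rw [sum_eq_zero fun i hi => by rw [h i hi, mul_zero]]
        simp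

/-! ### Almost regular recolouring by swapping two points. -/

/-- The intersection sizes of a set with the parts of `q`. -/
def intersectionSizes {V Q : Type*} [DecidableEq Q] (q : V → Q) (E : Finset V) (b : Q) : ℕ :=
  #{v ∈ E | q v = b}

section Recolouring

variable {V K Q : Type*} [DecidableEq V] [DecidableEq K] [DecidableEq Q]

/-- Swaps `α` and `β` in those sets that are selected by `s`. -/
def partialSwap (α β : V) (s : Finset V → Prop) [DecidablePred s] (E : Finset V) : Finset V :=
  if s (E \ {α, β}) then E.map (Equiv.swap α β).toEmbedding else E

variable {α β : V} (s : Finset V → Prop) [DecidablePred s]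

lemma map_swap_sdiff (E : Finset V) :
    E.map (Equiv.swap α β).toEmbedding \ {α, β} = E \ {α, β} := by
  ext v
  simp only [mem_sdiff, mem_map_equiv, Equiv.symm_swap, mem_insert, mem_singleton, not_or]
  refine and_congr_left fun h => ?_
  rw [Equiv.swap_apply_of_ne_of_ne h.1 h.2]

/-- The selection depends only on `E \ {α, β}`, which a swap does not change. Hence a partial swap
permutes the sets, and composing a colouring with it only redistributes colours. -/
lemma partialSwap_involutive : Function.Involutive (partialSwap α β s) := by
  intro E
  by_cases h : s (E \ {α, β})
  · rw [partialSwap, partialSwap, if_pos h, map_swap_sdiff, if_pos h]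
    ext v
    simp [mem_map_equiv]
  · rw [partialSwap, partialSwap, if_neg h, if_neg h]

lemma mem_partialSwap_of_ne {v : V} (h1 : v ≠ α) (h2 : v ≠ β) (E : Finset V) :
    v ∈ partialSwap α β s E ↔ v ∈ E := by
  unfold partialSwap
  split_ifs
  · rw [mem_map_equiv, Equiv.symm_swap, Equiv.swap_apply_of_ne_of_ne h1 h2]
  · rfl

lemma card_filter_partialSwap (q : V → Q) (hq : q α = q β) (b : Q) (E : Finset V) :
    #{v ∈ partialSwap α β s E | q v = b} = #{v ∈ E | q v = b} := by
  unfold partialSwap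
  split_ifs
  · rw [filter_map, card_map]
    congr 1
    refine filter_congr fun v _ => ?_
    have : q (Equiv.swap α β v) = q v := by
      rw [Equiv.swap_apply_def]
      split_ifs with h1 h2
      · rw [h1, hq]
      · rw [h2, hq]
      · rfl
    simp [this]
  · rfl

lemma partialSwap_insert_left {Y : Finset V} (h1 : α ∉ Y) (h2 : β ∉ Y) :
    partialSwap α β s (insert α Y) = if s Y then insert β Y else insert α Y := by
  have h : insert α Y \ {α, β} = Y := by grind
  rw [partialSwap, h]
  refine if_congr Iff.rfl ?_ rfl
  ext v
  rw [mem_map_equiv, Equiv.symm_swap, Equiv.swap_apply_def]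
  grind

lemma partialSwap_insert_right {Y : Finset V} (h1 : α ∉ Y) (h2 : β ∉ Y) :
    partialSwap α β s (insert β Y) = if s Y then insert α Y else insert β Y := by
  have h : insert β Y \ {α, β} = Y := by grind
  rw [partialSwap, h]
  refine if_congr Iff.rfl ?_ rfl
  ext v
  rw [mem_map_equiv, Equiv.symm_swap, Equiv.swap_apply_def]
  grind

lemma partialSwap_insert_insert (Y : Finset V) :
    partialSwap α β s (insert α (insert β Y)) = insert α (insert β Y) := by
  unfold partialSwap
  split_ifs
  · ext v
    rw [mem_map_equiv, Equiv.symm_swap, Equiv.swap_apply_def]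
    grind
  · rfl

variable [Fintype V]

/-- The number of sets of colour `κ` containing `v`. -/
def colourDegree (γ : Finset V → K) (κ : K) (v : V) : ℕ :=
  #{E : Finset V | γ E = κ ∧ v ∈ E}

/-- The multiset of the intersection sizes with the parts of `q` of the sets of colour `κ`. -/
def colourProfile (q : V → Q) (γ : Finset V → K) (κ : K) : Multiset (Q → ℕ) :=
  (univ.filter fun E : Finset V => γ E = κ).val.map (intersectionSizes q)

lemma colourProfile_comp_partialSwap (q : V → Q) (hq : q α = q β) (γ : Finset V → K) (κ : K) :
    colourProfile q (γ ∘ partialSwap α β s) κ = colourProfile q γ κ := by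
  unfold colourProfile
  have h : (univ.filter fun E : Finset V => γ E = κ)
      = (univ.filter fun E : Finset V => (γ ∘ partialSwap α β s) E = κ).map
        (partialSwap_involutive (α := α) (β := β) s).toPerm.toEmbedding := by
    ext E
    simp [mem_map_equiv, Function.Involutive.toPerm_symm, partialSwap_involutive s E]
  rw [h, map_val, Multiset.map_map]
  refine Multiset.map_congr rfl fun E _ => ?_
  funext b
  exact (card_filter_partialSwap s q hq b E).symm

lemma colourDegree_comp_partialSwap_of_ne (γ : Finset V → K) (κ : K) {v : V}
    (h1 : v ≠ α) (h2 : v ≠ β) :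
    colourDegree (γ ∘ partialSwap α β s) κ v = colourDegree γ κ v := by
  unfold colourDegree
  refine card_nbij' (partialSwap α β s) (partialSwap α β s) ?_ ?_ ?_ ?_
  · intro E; simp [mem_partialSwap_of_ne s h1 h2]
  · intro E; simp [mem_partialSwap_of_ne s h1 h2, partialSwap_involutive s E]
  · intro E _; exact partialSwap_involutive s E
  · intro E _; exact partialSwap_involutive s E

/-- The sets containing `α`, as a sum over the sets avoiding `α` and `β`. -/
lemma sum_ite_mem_eq (hαβ : α ≠ β) (F : Finset V → ℤ) :
    ∑ E : Finset V, (if α ∈ E then F E else 0)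
      = ∑ Y ∈ (univ \ {α, β}).powerset, (F (insert α Y) + F (insert α (insert β Y))) := by
  rw [sum_add_distrib, ← sum_filter]
  have h : (univ.filter fun E : Finset V => α ∈ E)
      = (univ.filter fun E : Finset V => α ∈ E ∧ β ∉ E)
        ∪ (univ.filter fun E : Finset V => α ∈ E ∧ β ∈ E) := by
    ext E; simp; tauto
  rw [h, sum_union (by rw [disjoint_left]; intro E; simp; tauto)]
  congr 1
  · refine sum_nbij' (fun E => E.erase α) (fun Y => insert α Y) ?_ ?_ ?_ ?_ ?_
    · intro E; simp only [mem_filter, mem_univ, true_and, mem_powerset, subset_iff, mem_erase,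
        mem_sdiff, mem_insert, mem_singleton]
      grind
    · intro Y; simp only [mem_filter, mem_univ, true_and, mem_powerset, subset_iff,
        mem_sdiff, mem_insert, mem_singleton]
      grind
    · intro E hE; simp at hE; exact insert_erase hE.1
    · intro Y hY
      simp only [mem_powerset, subset_iff, mem_sdiff, mem_insert, mem_singleton] at hY
      exact erase_insert fun h => by simpa using hY h
    · intro E hE; simp at hE; rw [insert_erase hE.1]
  · refine sum_nbij' (fun E => (E.erase α).erase β) (fun Y => insert α (insert β Y)) ?_ ?_ ?_ ?_ ?_
    · intro E; simp only [mem_filter, mem_univ, true_and, mem_powerset, subset_iff, mem_erase,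
        mem_sdiff, mem_insert, mem_singleton]
      grind
    · intro Y; simp only [mem_filter, mem_univ, true_and, mem_powerset, subset_iff,
        mem_sdiff, mem_insert, mem_singleton]
      grind
    · intro E hE; simp at hE; grind
    · intro Y hY
      simp only [mem_powerset, subset_iff, mem_sdiff, mem_insert, mem_singleton] at hY
      grind
    · intro E hE; simp at hE; congr 1; grind

lemma colourDegree_eq_sum (hαβ : α ≠ β) (γ : Finset V → K) (κ : K) :
    (colourDegree γ κ α : ℤ) = ∑ Y ∈ (univ \ {α, β}).powerset,
      ((if γ (insert α Y) = κ then 1 else 0)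
        + if γ (insert α (insert β Y)) = κ then (1 : ℤ) else 0) := by
  rw [← sum_ite_mem_eq hαβ fun E => if γ E = κ then (1 : ℤ) else 0, colourDegree, card_filter]
  push_cast
  refine sum_congr rfl fun E _ => ?_
  split_ifs <;> simp_all

/-- Some recolouring by swaps of `α` and `β` balances the degrees of `α` and `β` in every
colour. -/
lemma exists_partialSwap_balanced (hαβ : α ≠ β) (γ : Finset V → K) :
    ∃ s : Finset V → Prop, ∃ _ : DecidablePred s, ∀ κ,
      |(colourDegree (γ ∘ partialSwap α β s) κ α : ℤ)
        - colourDegree (γ ∘ partialSwap α β s) κ β| ≤ 1 ∧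
      (colourDegree (γ ∘ partialSwap α β s) κ α : ℤ) + colourDegree (γ ∘ partialSwap α β s) κ β
        = colourDegree γ κ α + colourDegree γ κ β := by
  -- The vertices of the multigraph are the colours; each `Y` avoiding `α` and `β` is an edge
  -- between the colours of `Y ∪ {α}` and `Y ∪ {β}`. Swapping at `Y` reverses that edge, and the
  -- signed sum at `κ` is the difference of the two degrees.
  obtain ⟨ε, hε, hsum⟩ := exists_balanced_orientation (univ \ {α, β}).powerset
    (fun Y κ => (if γ (insert α Y) = κ then (1 : ℤ) else 0) - if γ (insert β Y) = κ then 1 else 0)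
    (fun Y _ => ⟨_, _, fun κ => rfl⟩)
  have hY : ∀ Y ∈ (univ \ {α, β}).powerset, α ∉ Y ∧ β ∉ Y := by
    intro Y hY
    simp only [mem_powerset, subset_iff, mem_sdiff, mem_insert, mem_singleton] at hY
    exact ⟨fun h => by simpa using hY h, fun h => by simpa using hY h⟩
  refine ⟨fun Y => ε Y = -1, fun _ => inferInstance, fun κ => ⟨?_, ?_⟩⟩
  · rw [colourDegree_eq_sum hαβ, colourDegree_eq_sum hαβ.symm, pair_comm β α, ← sum_sub_distrib]
    refine (congrArg abs (sum_congr rfl fun Y hYm => ?_)).trans_le (hsum κ)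
    obtain ⟨h1, h2⟩ := hY Y hYm
    rw [insert_comm β α]
    simp only [Function.comp_apply, partialSwap_insert_left _ h1 h2,
      partialSwap_insert_right _ h1 h2]
    rcases hε Y with h | h <;> simp [h]
  · rw [colourDegree_eq_sum hαβ, colourDegree_eq_sum hαβ.symm, colourDegree_eq_sum hαβ,
      colourDegree_eq_sum hαβ.symm, pair_comm β α, ← sum_add_distrib, ← sum_add_distrib]
    refine sum_congr rfl fun Y hYm => ?_
    obtain ⟨h1, h2⟩ := hY Y hYm
    rw [insert_comm β α]
    simp only [Function.comp_apply, partialSwap_insert_left _ h1 h2,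
      partialSwap_insert_right _ h1 h2, partialSwap_insert_insert]
    rcases hε Y with h | h
    · simp [h]
    · simp [h]; ring

/-- Bryant's theorem on almost regular colourings of symmetric hypergraphs: sets can be
recoloured, keeping the intersection sizes with the parts of `q`, such that every colour class is
almost regular on every part. -/
theorem exists_almost_regular_colouring [Fintype K] (q : V → Q) (γ₀ : Finset V → K) :
    ∃ γ : Finset V → K, (∀ κ, colourProfile q γ κ = colourProfile q γ₀ κ) ∧
      ∀ κ α β, q α = q β → colourDegree γ κ α ≤ colourDegree γ κ β + 1 := by
  -- Minimise the sum of squared degrees. A balancing swap keeps the degree sum of `α` and `β` in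
  -- each colour, so it lowers the energy by half the drop in squared degree differences.
  let Φ : (Finset V → K) → ℤ := fun γ => ∑ κ, ∑ v, (colourDegree γ κ v : ℤ) ^ 2
  obtain ⟨γ, hγ, hmin⟩ := Set.exists_min_image
    {γ : Finset V → K | ∀ κ, colourProfile q γ κ = colourProfile q γ₀ κ} Φ (Set.toFinite _)
    ⟨γ₀, fun _ => rfl⟩
  refine ⟨γ, hγ, fun κ₀ α β hq => ?_⟩
  by_contra! hlt
  have hαβ : α ≠ β := by rintro rfl; omega
  obtain ⟨s, _, hs⟩ := exists_partialSwap_balanced hαβ γ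
  set γ' := γ ∘ partialSwap α β s with hγ'
  have hdiff : ∀ κ, ∑ v, (colourDegree γ κ v : ℤ) ^ 2 - ∑ v, (colourDegree γ' κ v : ℤ) ^ 2
      = (colourDegree γ κ α : ℤ) ^ 2 + (colourDegree γ κ β : ℤ) ^ 2
        - ((colourDegree γ' κ α : ℤ) ^ 2 + (colourDegree γ' κ β : ℤ) ^ 2) := by
    intro κ
    rw [← sum_sub_distrib, sum_eq_add α β hαβ]
    · ring
    · intro v _ hv
      rw [hγ', colourDegree_comp_partialSwap_of_ne s γ κ hv.1 hv.2, sub_self]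
    · simp
    · simp
  have hsq : ∀ κ, (2 : ℤ) * (∑ v, (colourDegree γ κ v : ℤ) ^ 2 - ∑ v, (colourDegree γ' κ v : ℤ) ^ 2)
      = ((colourDegree γ κ α : ℤ) - colourDegree γ κ β) ^ 2
        - ((colourDegree γ' κ α : ℤ) - colourDegree γ' κ β) ^ 2 := by
    intro κ
    have h := (hs κ).2
    rw [hdiff]
    linear_combination
      (-(colourDegree γ κ α : ℤ) - colourDegree γ κ β - colourDegree γ' κ α - colourDegree γ' κ β) * h
  have hle : ∀ κ, ∑ v, (colourDegree γ' κ v : ℤ) ^ 2 ≤ ∑ v, (colourDegree γ κ v : ℤ) ^ 2 := by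
    intro κ
    have h1 := hsq κ
    have h2 : ((colourDegree γ' κ α : ℤ) - colourDegree γ' κ β) ^ 2
        ≤ ((colourDegree γ κ α : ℤ) - colourDegree γ κ β) ^ 2 := by
      -- The new difference is at most 1 in absolute value and has the parity of the old one,
      -- because the sums agree; so it cannot exceed the old one.
      refine sq_le_sq.2 ?_
      have h3 := hs κ
      rw [abs_le] at h3
      rcases abs_cases ((colourDegree γ' κ α : ℤ) - colourDegree γ' κ β) with h4 | h4 <;>
        rcases abs_cases ((colourDegree γ κ α : ℤ) - colourDegree γ κ β) with h5 | h5 <;> omega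
    linarith
  have hlt' : ∑ v, (colourDegree γ' κ₀ v : ℤ) ^ 2 < ∑ v, (colourDegree γ κ₀ v : ℤ) ^ 2 := by
    have h1 := hsq κ₀
    have h2 : ((colourDegree γ' κ₀ α : ℤ) - colourDegree γ' κ₀ β) ^ 2
        < ((colourDegree γ κ₀ α : ℤ) - colourDegree γ κ₀ β) ^ 2 := by
      refine sq_lt_sq.2 ?_
      have h3 := (hs κ₀).1
      refine h3.trans_lt (lt_abs.2 (Or.inl ?_))
      omega
    linarith
  have hγ'mem : ∀ κ, colourProfile q γ' κ = colourProfile q γ₀ κ := fun κ =>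
    (colourProfile_comp_partialSwap s q hq γ κ).trans (hγ κ)
  exact absurd (hmin γ' hγ'mem) (not_le.2 (sum_lt_sum (fun κ _ => hle κ) ⟨κ₀, mem_univ _, hlt'⟩))

end Recolouring

/-! ### Packing disjoint groups into multisets. -/

/-- `A` contains `p` disjoint multisets satisfying `good`. -/
def Packs {T : Type*} (good : Multiset T → Prop) (p : ℕ) (A : Multiset T) : Prop :=
  ∃ G : Fin p → Multiset T, (∀ j, good (G j)) ∧ ∑ j, G j ≤ A

namespace Packs

variable {T : Type*} {good good' : Multiset T → Prop} {p p' q : ℕ} {A A' : Multiset T}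

lemma mono (h : Packs good p A) (hA : A ≤ A') : Packs good p A' := by
  obtain ⟨G, hG, hle⟩ := h
  exact ⟨G, hG, hle.trans hA⟩

lemma zero : Packs good 0 A := ⟨fun _ => 0, fun j => j.elim0, by simp⟩

lemma single (h : good A) : Packs good 1 A := ⟨fun _ => A, fun _ => h, by simp⟩

lemma add (h : Packs good p A) (h' : Packs good p' A') : Packs good (p + p') (A + A') := by
  obtain ⟨G, hG, hle⟩ := h
  obtain ⟨G', hG', hle'⟩ := h'
  refine ⟨Fin.append G G', fun j => ?_, ?_⟩
  · refine Fin.addCases (fun i => ?_) (fun i => ?_) j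
    · rw [Fin.append_left]; exact hG i
    · rw [Fin.append_right]; exact hG' i
  · rw [Fin.sum_univ_add]
    simp only [Fin.append_left, Fin.append_right]
    exact add_le_add hle hle'

lemma nsmul (h : Packs good p A) (d : ℕ) : Packs good (d * p) (d • A) := by
  induction d with
  | zero => rw [zero_mul]; exact zero
  | succ d ih => rw [add_mul, one_mul, add_nsmul, one_nsmul]; exact ih.add h

lemma of_le (h : Packs good p A) (hq : q ≤ p) : Packs good q A := by
  obtain ⟨G, hG, hle⟩ := h
  obtain ⟨e, rfl⟩ := Nat.exists_eq_add_of_le hq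
  refine ⟨fun j => G (Fin.castAdd e j), fun j => hG _, le_trans ?_ hle⟩
  rw [Fin.sum_univ_add]
  exact Multiset.le_add_right _ _

lemma finsetSum {ι : Type*} (S : Finset ι) (B : ι → Multiset T)
    (h : ∀ i ∈ S, good (B i)) : Packs good S.card (∑ i ∈ S, B i) := by
  classical
  induction S using Finset.induction_on with
  | empty => exact zero
  | insert i S hi ih =>
    rw [card_insert_of_notMem hi, sum_insert hi, add_comm (S.card)]
    exact (single (h i (mem_insert_self _ _))).add
      (ih fun j hj => h j (mem_insert_of_mem hj))

/-- Combines one group satisfying `good` with `q` groups satisfying `good'`. -/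
lemma combine {good'' : Multiset T → Prop} (h : Packs good p A) (h' : Packs good' (p * q) A')
    (hgood : ∀ (B : Multiset T) (C : Fin q → Multiset T), good B → (∀ l, good' (C l)) →
      good'' (B + ∑ l, C l)) : Packs good'' p (A + A') := by
  obtain ⟨G, hG, hle⟩ := h
  obtain ⟨G', hG', hle'⟩ := h'
  refine ⟨fun j => G j + ∑ l, G' (finProdFinEquiv (j, l)),
    fun j => hgood _ _ (hG j) fun l => hG' _, ?_⟩
  rw [sum_add_distrib]
  refine add_le_add hle (le_trans (le_of_eq ?_) hle')
  rw [← Equiv.sum_comp finProdFinEquiv, Fintype.sum_prod_type]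

end Packs

/-! ### Centred pairs and triples of integers. -/

/-- `B` has `s` members whose mean is `L / 2`. -/
def IsCentred (L s : ℕ) (B : Multiset ℕ) : Prop := B.card = s ∧ 2 * B.sum = s * L

lemma IsCentred.add {L s s' : ℕ} {B B' : Multiset ℕ} (h : IsCentred L s B)
    (h' : IsCentred L s' B') : IsCentred L (s + s') (B + B') := by
  refine ⟨by rw [Multiset.card_add, h.1, h'.1], ?_⟩
  rw [Multiset.sum_add, mul_add, h.2, h'.2, add_mul]

lemma IsCentred.sum {L s q : ℕ} {C : Fin q → Multiset ℕ} (h : ∀ l, IsCentred L s (C l)) :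
    IsCentred L (q * s) (∑ l, C l) := by
  induction q with
  | zero => simp [IsCentred]
  | succ q ih =>
    rw [Fin.sum_univ_castSucc, add_mul, one_mul]
    exact (ih fun l => h _).add (h _)

lemma isCentred_pair {L i j : ℕ} (h : i + j = L) : IsCentred L 2 {i, j} := by
  subst h
  exact ⟨rfl, by simp⟩

/-- A multiset that is symmetric about `L / 2` contains the expected number of centred pairs. -/
lemma packs_pairs_of_symmetric {L q : ℕ} (A : Multiset ℕ) (hL : ∀ i ∈ A, i ≤ L)
    (hsymm : A.map (L - ·) = A) (hq : 2 * q ≤ A.card) : Packs (IsCentred L 2) q A := by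
  induction q generalizing A with
  | zero => exact Packs.zero
  | succ q ih =>
    obtain ⟨i, hi, hmem⟩ : ∃ i ∈ A, L - i ∈ A.erase i := by
      -- Without a pair, symmetry forces every member to be fixed by the reflection. Two members
      -- then both lie at `L / 2` and form a pair after all.
      by_contra! hno
      have hfix : ∀ i ∈ A, L - i = i := by
        intro i hi
        by_contra hne
        refine hno i hi ((Multiset.mem_erase_of_ne hne).2 ?_)
        have h := Multiset.mem_map_of_mem (L - ·) hi
        rwa [hsymm] at h
      obtain ⟨i, hi⟩ : ∃ i, i ∈ A := Multiset.card_pos_iff_exists_mem.1 (by omega)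
      obtain ⟨j, hj⟩ : ∃ j, j ∈ A.erase i := Multiset.card_pos_iff_exists_mem.1 (by
        rw [Multiset.card_erase_of_mem hi]; simp; omega)
      have hjA := Multiset.mem_of_mem_erase hj
      have h1 := hfix i hi
      have h2 := hfix j hjA
      have h3 := hL i hi
      have h4 := hL j hjA
      have hij : L - i = j := by omega
      exact hno i hi (hij ▸ hj)
    have hiL := hL i hi
    obtain ⟨B, rfl⟩ := Multiset.exists_cons_of_mem hi
    rw [Multiset.erase_cons_head] at hmem
    obtain ⟨C, rfl⟩ := Multiset.exists_cons_of_mem hmem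
    have hC : C.map (L - ·) = C := by
      simp only [Multiset.map_cons, Nat.sub_sub_self hiL] at hsymm
      rw [Multiset.cons_swap] at hsymm
      simpa using hsymm
    have h := (ih C (fun j hj => hL j (by simp [hj])) hC (by simp at hq; omega)).add
      (Packs.single (isCentred_pair (Nat.add_sub_cancel' hiL)))
    refine h.mono (le_of_eq ?_)
    ext x
    simp only [Multiset.count_add, Multiset.insert_eq_cons, Multiset.count_cons,
      Multiset.count_singleton]
    ring

/-- The multiset over `S` with multiplicities `w`. -/
def weighted {T : Type*} (S : Finset T) (w : T → ℕ) : Multiset T := ∑ i ∈ S, w i • {i}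

section Weighted

variable {T : Type*} (S : Finset T) (w : T → ℕ)

lemma card_weighted : (weighted S w).card = ∑ i ∈ S, w i := by
  simp [weighted, Multiset.card_sum]

lemma mem_of_mem_weighted {i : T} (h : i ∈ weighted S w) : i ∈ S := by
  obtain ⟨j, hj, hi⟩ := Multiset.mem_sum.1 h
  have := Multiset.mem_of_mem_nsmul hi
  rw [Multiset.mem_singleton] at this
  rwa [this]

lemma map_weighted {T' : Type*} (f : T → T') :
    (weighted S w).map f = ∑ i ∈ S, w i • ({f i} : Multiset T') := by
  rw [weighted, ← Multiset.coe_mapAddMonoidHom, map_sum]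
  exact sum_congr rfl fun i _ => by rw [map_nsmul]; rfl

lemma map_weighted_of_injOn {T' : Type*} [DecidableEq T'] (f : T → T') (hf : Set.InjOn f S)
    (w' : T' → ℕ) (hw : ∀ i ∈ S, w' (f i) = w i) :
    (weighted S w).map f = weighted (S.image f) w' := by
  rw [map_weighted, weighted, sum_image hf]
  exact sum_congr rfl fun i hi => by rw [hw i hi]

lemma weighted_congr {w w' : T → ℕ} (h : ∀ i ∈ S, w i = w' i) : weighted S w = weighted S w' :=
  sum_congr rfl fun i hi => by rw [h i hi]

lemma weighted_add (w' : T → ℕ) :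
    weighted S (fun i => w i + w' i) = weighted S w + weighted S w' := by
  simp only [weighted, add_nsmul, sum_add_distrib]

lemma weighted_const (n : ℕ) : weighted S (fun _ => n) = n • S.val := by
  rw [weighted, ← smul_sum, sum_multiset_singleton]

lemma count_weighted [DecidableEq T] (i : T) :
    (weighted S w).count i = if i ∈ S then w i else 0 := by
  rw [weighted, Multiset.count_sum']
  simp [Multiset.count_nsmul, Multiset.count_singleton]

end Weighted

lemma packs_pairs_weighted {L q : ℕ} (S : Finset ℕ) (w : ℕ → ℕ) (hS : ∀ i ∈ S, i ≤ L ∧ L - i ∈ S)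
    (hw : ∀ i ∈ S, w (L - i) = w i) (hq : 2 * q ≤ ∑ i ∈ S, w i) :
    Packs (IsCentred L 2) q (weighted S w) := by
  refine packs_pairs_of_symmetric _ (fun i hi => (hS i (mem_of_mem_weighted S w hi)).1) ?_
    (by rwa [card_weighted])
  rw [map_weighted_of_injOn S w (L - ·) (fun i hi j hj hij => ?_) w hw]
  · congr 1
    refine eq_of_subset_of_card_le (image_subset_iff.2 fun i hi => (hS i hi).2) ?_
    rw [card_image_of_injOn]
    intro i hi j hj hij
    have h1 := (hS i hi).1
    have h2 := (hS j hj).1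
    simp only at hij
    omega
  · have h1 := (hS i hi).1
    have h2 := (hS j hj).1
    simp only at hij
    omega

/-- Three copies of an integer interval decompose into triples with constant sum. -/
lemma packs_triples_interval (lo h : ℕ) :
    Packs (IsCentred (2 * (lo + h)) 3) (2 * h + 1) (3 • (Icc lo (lo + 2 * h)).val) := by
  have himage : ∀ f : ℕ → ℕ, (∀ i ∈ range (2 * h + 1), f i ∈ Icc lo (lo + 2 * h)) →
      (∀ i ∈ range (2 * h + 1), ∀ j ∈ range (2 * h + 1), f i = f j → i = j) →
      (range (2 * h + 1)).val.map f = (Icc lo (lo + 2 * h)).val := by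
    intro f h1 h2
    have h3 : (range (2 * h + 1)).image f = Icc lo (lo + 2 * h) := by
      refine eq_of_subset_of_card_le (image_subset_iff.2 h1) ?_
      rw [card_image_of_injOn fun i hi j hj hij => h2 i hi j hj hij]
      simp; omega
    rw [← h3, image_val_of_injOn fun i hi j hj hij => h2 i hi j hj hij]
  have hsum : ∀ f : ℕ → ℕ, ∑ i ∈ range (2 * h + 1), ({f i} : Multiset ℕ)
      = (range (2 * h + 1)).val.map f := fun f => by
    rw [← sum_multiset_singleton, ← Multiset.coe_mapAddMonoidHom, map_sum]; rfl
  -- As `f₁` climbs through the interval, `f₂` and `f₃` alternate between descending through its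
  -- lower and upper halves; each is a bijection onto the interval.
  let f₁ : ℕ → ℕ := fun i => lo + i
  let f₂ : ℕ → ℕ := fun i => if i % 2 = 0 then lo + h - i / 2 else lo + 2 * h - i / 2
  let f₃ : ℕ → ℕ := fun i => if i % 2 = 0 then lo + 2 * h - i / 2 else lo + h - (i + 1) / 2
  have hp := Packs.finsetSum (good := IsCentred (2 * (lo + h)) 3) (range (2 * h + 1))
    (fun i => {f₁ i} + {f₂ i} + {f₃ i}) (by
      intro i hi
      refine ⟨rfl, ?_⟩
      simp only [mem_range] at hi
      simp only [f₁, f₂, f₃, Multiset.sum_add, Multiset.sum_singleton]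
      split_ifs <;> omega)
  rw [card_range] at hp
  refine hp.mono (le_of_eq ?_)
  rw [sum_add_distrib, sum_add_distrib, hsum, hsum, hsum, himage f₁, himage f₂, himage f₃]
  · rw [succ_nsmul, two_nsmul]
  all_goals
    simp only [f₁, f₂, f₃, mem_range, mem_Icc]
    intros
    grind

lemma Icc_sub_add_succ {g h : ℕ} (hg : h + 1 ≤ g) :
    Icc (g - (h + 1)) (g + (h + 1))
      = insert (g - (h + 1)) (insert (g + (h + 1)) (Icc (g - h) (g + h))) := by
  ext i
  simp only [mem_insert, mem_Icc]
  omega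

lemma sum_Icc_sub_add_succ {M : Type*} [AddCommMonoid M] {g h : ℕ} (hg : h + 1 ≤ g) (f : ℕ → M) :
    ∑ i ∈ Icc (g - (h + 1)) (g + (h + 1)), f i
      = f (g - (h + 1)) + f (g + (h + 1)) + ∑ i ∈ Icc (g - h) (g + h), f i := by
  rw [Icc_sub_add_succ hg, sum_insert, sum_insert, add_assoc]
  · simp only [mem_Icc]; omega
  · simp only [mem_insert, mem_Icc]; omega

/-- A symmetric unimodal multiset with a large enough mode contains any prescribed numbers of
centred triples and pairs that its cardinality allows. -/
lemma packs_triples_pairs_unimodal {g : ℕ} (h : ℕ) (hg : h ≤ g) (w : ℕ → ℕ) (p q : ℕ)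
    (hsymm : ∀ e ≤ h, w (g - e) = w (g + e))
    (hanti : ∀ e e', e ≤ e' → e' ≤ h → w (g + e') ≤ w (g + e))
    (hgap : 1 ≤ h → w (g + 1) + 2 * h ≤ w g)
    (hcard : 3 * p + 2 * q ≤ ∑ i ∈ Icc (g - h) (g + h), w i) :
    ∃ A B : Multiset ℕ, A + B ≤ weighted (Icc (g - h) (g + h)) w ∧
      Packs (IsCentred (2 * g) 3) p A ∧ Packs (IsCentred (2 * g) 2) q B := by
  have hone : IsCentred (2 * g) 1 {g} := ⟨rfl, by simp⟩
  induction h generalizing w p q with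
  | zero =>
    simp only [Nat.sub_zero, add_zero, Icc_self, sum_singleton, weighted] at hcard ⊢
    refine ⟨p • (3 • {g}), q • (2 • {g}), ?_, ?_, ?_⟩
    · rw [← mul_nsmul, ← mul_nsmul, ← add_nsmul]
      exact nsmul_le_nsmul_left zero_le hcard
    · have := (Packs.single (hone.add (hone.add hone))).nsmul p
      rw [mul_one] at this
      exact this.mono (le_of_eq (by rw [succ_nsmul, two_nsmul, add_assoc]))
    · have := (Packs.single (hone.add hone)).nsmul q
      rw [mul_one] at this
      exact this.mono (le_of_eq (by rw [two_nsmul]))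
  | succ h ih =>
    set P : Multiset ℕ := {g - (h + 1), g + (h + 1)} with hP
    have hPc : IsCentred (2 * g) 2 P := isCentred_pair (by omega)
    have hPadd : P = {g - (h + 1)} + {g + (h + 1)} := rfl
    have htop : w (g - (h + 1)) = w (g + (h + 1)) := hsymm _ le_rfl
    have hW : weighted (Icc (g - (h + 1)) (g + (h + 1))) w
        = w (g + (h + 1)) • P + weighted (Icc (g - h) (g + h)) w := by
      rw [weighted, sum_Icc_sub_add_succ hg, htop, hPadd, nsmul_add, weighted]
    rw [sum_Icc_sub_add_succ hg, htop] at hcard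
    have hgap' := hgap (by omega)
    have hN1 := hanti 1 (h + 1) (by omega) le_rfl
    rw [hW]
    set N := w (g + (h + 1)) with hN
    -- Use up the `N` outermost symmetric pairs `P`. If `q` pairs are still needed at least `N`
    -- times, all of them serve as pairs; otherwise the surplus `N - q` must go into triples.
    rcases le_or_gt N q with hq | hq
    · obtain ⟨A, B, hAB, hA, hB⟩ := ih (by omega) w p (q - N) (fun e he => hsymm e (by omega))
        (fun e e' h1 h2 => hanti e e' h1 (by omega)) (fun _ => by omega) (by omega)
      refine ⟨A, N • P + B, ?_, hA, ?_⟩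
      · rw [add_left_comm]
        exact add_le_add_right hAB _
      · have := ((Packs.single hPc).nsmul N).add hB
        rw [mul_one] at this
        exact this.of_le (by omega)
    · obtain ⟨d, ρ, hρ, hd⟩ : ∃ d ρ, ρ ≤ 2 ∧ N = q + 3 * d + ρ :=
        ⟨(N - q) / 3, (N - q) % 3, by omega, by omega⟩
      set w' : ℕ → ℕ := fun i => w i - 3 * d - if i = g then ρ else 0 with hw'
      have hge : ∀ e ≤ h, 3 * d ≤ w (g + e) := fun e he => by
        have := hanti e (h + 1) (by omega) le_rfl; omega
      have hww' : ∀ i ∈ Icc (g - h) (g + h), w i = 3 * d + (if i = g then ρ else 0) + w' i := by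
        intro i hi
        rw [mem_Icc] at hi
        by_cases hig : i = g
        · simp only [hw', hig, if_true]; omega
        · have : 3 * d ≤ w i := by
            rcases le_total i g with hle | hle
            · have h1 := hge (g - i) (by omega)
              have h2 := hsymm (g - i) (by omega)
              rw [← h2] at h1
              rwa [Nat.sub_sub_self hle] at h1
            · have h1 := hge (i - g) (by omega)
              rwa [Nat.add_sub_cancel' hle] at h1
          simp only [hw', if_neg hig]; omega
      have hgmem : g ∈ Icc (g - h) (g + h) := by rw [mem_Icc]; omega
      have hcardI : (Icc (g - h) (g + h)).card = 2 * h + 1 := by rw [Nat.card_Icc]; omega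
      have hsum : ∑ i ∈ Icc (g - h) (g + h), w i
          = 3 * (d * (2 * h + 1)) + ρ + ∑ i ∈ Icc (g - h) (g + h), w' i := by
        rw [sum_congr rfl hww', sum_add_distrib, sum_add_distrib, sum_const, hcardI,
          sum_ite_eq' _ g, if_pos hgmem, smul_eq_mul]
        ring
      have hWh : weighted (Icc (g - h) (g + h)) w = (3 * d) • (Icc (g - h) (g + h)).val
          + ρ • {g} + weighted (Icc (g - h) (g + h)) w' := by
        rw [weighted_congr _ hww', weighted_add, weighted_add, weighted_const]
        congr 2
        simp [weighted, ite_smul, sum_ite_eq', hgmem]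
      have hval : (Icc (g - (h + 1)) (g + (h + 1))).val = P + (Icc (g - h) (g + h)).val := by
        rw [← sum_multiset_singleton, sum_Icc_sub_add_succ hg, sum_multiset_singleton, hPadd]
      obtain ⟨A, B, hAB, hA, -⟩ := ih (by omega) w' (p - (d * (2 * h + 1) + 2 * d + ρ)) 0
        (fun e he => by
          have h1 := hsymm e (by omega)
          have h2 : g - e = g ↔ g + e = g := by omega
          simp only [hw', h1, h2])
        (fun e e' h1 h2 => by
          have h3 := hanti e e' h1 (by omega)
          rcases Nat.eq_zero_or_pos e with he | he
          · rcases Nat.eq_zero_or_pos e' with he' | he'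
            · rw [he, he']
            · have h4 := hanti 1 e' he' (by omega)
              have h5 : ¬ g + e' = g := by omega
              simp only [hw', he, add_zero, if_true, if_neg h5]
              omega
          · have h5 : ¬ g + e' = g := by omega
            have h6 : ¬ g + e = g := by omega
            simp only [hw', if_neg h5, if_neg h6]
            omega)
        -- Lowering the mode by `ρ ≤ 2` costs at most 2 of the gap, which is exactly what the term
        -- `2 * h` allows per layer.
        (fun h1 => by
          have h5 : ¬ g + 1 = g := by omega
          have h6 := hge 1 h1
          simp only [hw', if_neg h5, if_true]
          omega)
        (by omega)
      have htri := packs_triples_interval (g - (h + 1)) (h + 1)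
      rw [Nat.sub_add_cancel hg, show g - (h + 1) + 2 * (h + 1) = g + (h + 1) by omega] at htri
      refine ⟨d • (3 • (P + (Icc (g - h) (g + h)).val)) + ρ • (P + {g}) + A, q • P, ?_, ?_, ?_⟩
      · rw [hWh, hd]
        have hle : A ≤ weighted (Icc (g - h) (g + h)) w' := (Multiset.le_add_right _ _).trans hAB
        refine le_trans (add_le_add_left (add_le_add_right hle _) _) (le_of_eq ?_)
        simp only [add_nsmul, mul_nsmul, nsmul_add]
        abel
      · rw [hval] at htri
        have := ((htri.nsmul d).add ((Packs.single (hPc.add hone)).nsmul ρ)).add hA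
        refine this.of_le ?_
        have : d * (2 * (h + 1) + 1) = d * (2 * h + 1) + 2 * d := by ring
        omega
      · have := (Packs.single hPc).nsmul q
        rwa [mul_one] at this

lemma packs_of_even {L s p : ℕ} (hs : Even s) (S : Finset ℕ) (w : ℕ → ℕ)
    (hS : ∀ i ∈ S, i ≤ L ∧ L - i ∈ S) (hw : ∀ i ∈ S, w (L - i) = w i)
    (hp : s * p ≤ ∑ i ∈ S, w i) : Packs (IsCentred L s) p (weighted S w) := by
  obtain ⟨q, rfl⟩ := hs
  -- Empty base groups, so that each final group consists of `q` pairs only.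
  have h0 : Packs (IsCentred L 0) p 0 := ⟨fun _ => 0, fun _ => ⟨rfl, by simp⟩, by simp⟩
  have h1 : Packs (IsCentred L 2) (p * q) (weighted S w) :=
    packs_pairs_weighted S w hS hw (le_trans (le_of_eq (by ring)) hp)
  rw [← zero_add (weighted S w)]
  refine h0.combine h1 fun B C hB hC => ?_
  have := hB.add (IsCentred.sum hC)
  rwa [show 0 + q * 2 = q + q by ring] at this

/-! ### Unimodality and peak of products of binomial coefficients. -/

/-- The product of binomial coefficients counting the sets with `i` members in one part of size
`m` and `L - i` in another. -/
def splitCount (m L i : ℕ) : ℕ := m.choose i * m.choose (L - i)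

lemma splitCount_symm {m L i : ℕ} (hi : i ≤ L) : splitCount m L (L - i) = splitCount m L i := by
  rw [splitCount, splitCount, Nat.sub_sub_self hi, mul_comm]

/-- The ratio of consecutive terms, cleared of denominators; both monotonicity and the gap at the
peak are read off from it. -/
lemma splitCount_succ_mul {m g e : ℕ} (he : e + 1 ≤ g) :
    splitCount m (2 * g) (g + (e + 1)) * ((g + e + 1) * (m - (g - (e + 1))))
      = splitCount m (2 * g) (g + e) * ((m - (g + e)) * (g - e)) := by
  have h1 := Nat.choose_succ_right_eq m (g + e)
  have h2 := Nat.choose_succ_right_eq m (g - (e + 1))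
  rw [show g - (e + 1) + 1 = g - e by omega] at h2
  rw [splitCount, splitCount, show 2 * g - (g + (e + 1)) = g - (e + 1) by omega,
    show 2 * g - (g + e) = g - e by omega, ← add_assoc]
  calc _ = (m.choose (g + e + 1) * (g + e + 1))
        * (m.choose (g - (e + 1)) * (m - (g - (e + 1)))) := by ring
    _ = _ := by rw [h1, ← h2]; ring

lemma splitCount_succ_le {m g e : ℕ} (he : e + 1 ≤ g) (hm : g ≤ m) :
    splitCount m (2 * g) (g + (e + 1)) ≤ splitCount m (2 * g) (g + e) := by
  have h := splitCount_succ_mul (m := m) he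
  have hpos : 0 < (g + e + 1) * (m - (g - (e + 1))) := Nat.mul_pos (by omega) (by omega)
  refine Nat.le_of_mul_le_mul_right (h.trans_le (Nat.mul_le_mul_left _ ?_)) hpos
  rw [mul_comm]
  exact Nat.mul_le_mul (by omega) (by omega)

lemma splitCount_anti {m g e e' : ℕ} (hee : e ≤ e') (he' : e' ≤ g) (hm : g ≤ m) :
    splitCount m (2 * g) (g + e') ≤ splitCount m (2 * g) (g + e) := by
  induction e', hee using Nat.le_induction with
  | base => exact le_rfl
  | succ e' _ ih => exact (splitCount_succ_le he' hm).trans (ih (by omega))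

lemma le_choose_of_two_mul_le {m g : ℕ} (hg : 1 ≤ g) (hm : 2 * g ≤ m) : m ≤ m.choose g := by
  induction g, hg using Nat.le_induction with
  | base => simp
  | succ g _ ih => exact (ih (by omega)).trans (Nat.choose_le_succ_of_lt_half_left (by omega))

/-- With `l = m - g`, the drop from the peak value `x` is `x (g + l + 1) / ((g + 1) (l + 1))`. A
drop below `2 * g` would give `x < 2 * g * (g + 1)`, whereas `x` is the square of `m.choose g ≥ m ≥
5 * g`. -/
lemma splitCount_gap {m g : ℕ} (hg : 1 ≤ g) (hm : 5 * g ≤ m) :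
    splitCount m (2 * g) (g + 1) + 2 * g ≤ splitCount m (2 * g) g := by
  by_contra! hlt
  have h := splitCount_succ_mul (m := m) (g := g) (e := 0) hg
  simp only [zero_add, add_zero, Nat.sub_zero] at h
  obtain ⟨l, rfl⟩ := Nat.exists_eq_add_of_le (show g ≤ m by omega)
  rw [show g + l - (g - 1) = l + 1 by omega, Nat.add_sub_cancel_left] at h
  have hbig : (5 * g) * (5 * g) ≤ splitCount (g + l) (2 * g) g := by
    have h1 := hm.trans (le_choose_of_two_mul_le hg (by omega : 2 * g ≤ g + l))
    rw [splitCount, show 2 * g - g = g by omega]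
    exact Nat.mul_le_mul h1 h1
  set x := splitCount (g + l) (2 * g) g
  set y := splitCount (g + l) (2 * g) (g + 1)
  have h1 : x * (g + l + 1) < 2 * g * ((g + 1) * (l + 1)) := by
    have h2 : x * ((g + 1) * (l + 1)) < (y + 2 * g) * ((g + 1) * (l + 1)) :=
      Nat.mul_lt_mul_of_pos_right hlt (by positivity)
    nlinarith
  have h3 : x * (g + l + 1) < 2 * g * (g + 1) * (g + l + 1) := by
    refine h1.trans_le ?_
    rw [← mul_assoc]
    exact Nat.mul_le_mul_left _ (by omega)
  have h4 := Nat.lt_of_mul_lt_mul_right h3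
  nlinarith

/-- The intersection sizes of the small sets split into centred groups of odd size `s`. -/
lemma packs_of_odd {m g u s p : ℕ} (hs : Odd s) (hs3 : 3 ≤ s) (hu : 1 ≤ u) (hug : u ≤ g)
    (hm : 5 * g ≤ m) (hp : s * p ≤ ∑ i ∈ Icc u (2 * g - u), splitCount m (2 * g) i) :
    Packs (IsCentred (2 * g) s) p (weighted (Icc u (2 * g - u)) (splitCount m (2 * g))) := by
  obtain ⟨q, rfl⟩ : ∃ q, s = 3 + q * 2 := by
    obtain ⟨t, rfl⟩ := hs; exact ⟨t - 1, by omega⟩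
  have hlo : u = g - (g - u) := by omega
  have hhi : 2 * g - u = g + (g - u) := by omega
  rw [hhi] at hp ⊢
  generalize hh : g - u = h at *
  subst hlo
  obtain ⟨A, B, hAB, hA, hB⟩ := packs_triples_pairs_unimodal h (by omega) (splitCount m (2 * g))
    p (p * q)
    (fun e he => by
      rw [← splitCount_symm (i := g + e) (by omega)]; congr 1; omega)
    (fun e e' h1 h2 => splitCount_anti h1 (by omega) (by omega))
    (fun _ => by have := splitCount_gap (m := m) (g := g) (by omega) hm; omega)
    (le_trans (le_of_eq (by ring)) hp)
  exact (hA.combine hB fun B C hB hC => hB.add (IsCentred.sum hC)).mono hAB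

/-! ### From prescribed intersection sizes to partitions. -/

lemma exists_colouring_card {X : Type*} [DecidableEq X] (F : Finset X) {p : ℕ} (N : Fin p → ℕ)
    (h : ∑ j, N j ≤ #F) :
    ∃ γ : X → Option (Fin p), ∀ j, #{x ∈ F | γ x = some j} = N j := by
  obtain ⟨e⟩ : Nonempty ((Σ j, Fin (N j)) ↪ F) :=
    Function.Embedding.nonempty_of_card_le (by simpa using h)
  classical
  let γ : X → Option (Fin p) := fun x =>
    if hx : ∃ a, (e a : X) = x then some hx.choose.1 else none
  have hγ : ∀ a, γ (e a) = some a.1 := by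
    intro a
    have hx : ∃ b, (e b : X) = e a := ⟨a, rfl⟩
    have := e.injective (Subtype.ext hx.choose_spec)
    simp only [γ, dif_pos hx, this]
  refine ⟨γ, fun j => ?_⟩
  rw [← Fintype.card_fin (N j), ← card_univ]
  symm
  refine card_bij (fun l _ => (e ⟨j, l⟩ : X)) ?_ ?_ ?_
  · intro l _
    simp [hγ]
  · intro l _ l' _ hl
    simpa using e.injective (Subtype.ext hl)
  · intro x hx
    rw [mem_filter] at hx
    by_cases hex : ∃ a, (e a : X) = x
    · obtain ⟨⟨j', l⟩, rfl⟩ := hex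
      rw [hγ] at hx
      obtain rfl : j' = j := by simpa using hx.2
      exact ⟨l, mem_univ _, rfl⟩
    · have hnone : γ x = none := dif_neg hex
      simp [hnone] at hx

lemma exists_colouring_map {X T : Type*} [Fintype X] [DecidableEq X] [DecidableEq T] (t : X → T)
    {p : ℕ} (H : Fin p → Multiset T) (h : ∑ j, H j ≤ (univ : Finset X).val.map t) :
    ∃ γ : X → Option (Fin p), ∀ j, (univ.filter fun x => γ x = some j).val.map t = H j := by
  have hτ : ∀ τ : T, ∃ γ : X → Option (Fin p),
      ∀ j, #{x ∈ (univ.filter fun x => τ = t x) | γ x = some j} = (H j).count τ := by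
    intro τ
    refine exists_colouring_card _ _ ?_
    rw [← Multiset.count_sum']
    have := Multiset.le_iff_count.1 h τ
    rwa [Multiset.count_map] at this
  choose γ hγ using hτ
  -- Each type is coloured independently, and every element uses the colouring of its own type.
  refine ⟨fun x => γ (t x) x, fun j => Multiset.ext.2 fun τ => ?_⟩
  rw [Multiset.count_map, ← hγ τ j, filter_filter, ← filter_val, filter_filter, card_def]
  congr 2
  ext x
  simp only [mem_filter, mem_univ, true_and]
  constructor
  · rintro ⟨h1, rfl⟩; exact ⟨rfl, h1⟩
  · rintro ⟨rfl, h1⟩; exact ⟨h1, rfl⟩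

/-- Prescribed intersection sizes that add up correctly can be realised by partitions. -/
theorem exists_partition_colouring {V Q : Type*} [Fintype V] [DecidableEq V] [Fintype Q]
    [DecidableEq Q] (q : V → Q) {p : ℕ} (H : Fin p → Multiset (Q → ℕ))
    (hH : ∑ j, H j ≤ (univ : Finset (Finset V)).val.map (intersectionSizes q))
    (hsum : ∀ j b, ((H j).map fun τ => τ b).sum = #{v | q v = b}) :
    ∃ γ : Finset V → Option (Fin p),
      (∀ j, (univ.filter fun E => γ E = some j).val.map (intersectionSizes q) = H j) ∧
      ∀ j v, ∃! E, γ E = some j ∧ v ∈ E := by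
  obtain ⟨γ₀, hγ₀⟩ := exists_colouring_map (intersectionSizes q) H hH
  obtain ⟨γ, hγ, hreg⟩ := exists_almost_regular_colouring q γ₀
  have hprof : ∀ j, (univ.filter fun E => γ E = some j).val.map (intersectionSizes q) = H j :=
    fun j => (hγ (some j)).trans (hγ₀ j)
  refine ⟨γ, hprof, fun j v => ?_⟩
  have hdeg : ∀ b, ∑ v ∈ univ.filter (fun v => q v = b), colourDegree γ (some j) v
      = #{v | q v = b} := by
    intro b
    rw [← hsum j b, ← hprof j, Multiset.map_map]
    change _ = ∑ E ∈ univ.filter (fun E => γ E = some j), #{v ∈ E | q v = b}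
    refine (sum_congr rfl fun v _ => ?_).trans
      ((sum_card_bipartiteAbove_eq_sum_card_bipartiteBelow fun v E => v ∈ E).trans
        (sum_congr rfl fun E _ => ?_))
    · rw [colourDegree, bipartiteAbove, filter_filter]
    · rw [bipartiteBelow, filter_filter]
      congr 1
      ext v
      simp [and_comm]
  -- The degrees average 1 on each part and differ by at most 1 there, so a single deviation would
  -- shift the sum.
  have hone : colourDegree γ (some j) v = 1 := by
    have hv : v ∈ univ.filter (fun v' => q v' = q v) := by simp
    by_contra hne
    have h := hdeg (q v)
    rw [card_eq_sum_ones] at h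
    rcases Nat.lt_or_gt_of_ne hne with hlt | hlt
    · refine absurd h (ne_of_lt (sum_lt_sum (fun v' hv' => ?_) ⟨v, hv, hlt⟩))
      have := hreg (some j) v' v (mem_filter.1 hv').2
      omega
    · refine absurd h (ne_of_gt (sum_lt_sum (fun v' hv' => ?_) ⟨v, hv, hlt⟩))
      have := hreg (some j) v v' (mem_filter.1 hv').2.symm
      omega
  obtain ⟨E, hE⟩ := card_eq_one.1 hone
  refine ⟨E, ?_, fun E' hE' => ?_⟩
  · have : E ∈ ({E} : Finset (Finset V)) := mem_singleton_self E
    rw [← hE] at this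
    simpa using this
  · have : E' ∈ (univ.filter fun E => γ E = some j ∧ v ∈ E) := by simpa using hE'
    rw [hE] at this
    exact mem_singleton.1 this

/-- Colour classes covering every point exactly once give distinct partitions. -/
lemma exists_finpartition_family {V : Type*} [Fintype V] [DecidableEq V] [Nonempty V] {p : ℕ}
    (γ : Finset V → Option (Fin p)) (hγ : ∀ j v, ∃! E, γ E = some j ∧ v ∈ E)
    (hempty : ∀ j, γ ∅ ≠ some j) :
    ∃ π : Fin p ↪ Finpartition (univ : Finset V), ∀ j A, A ∈ (π j).parts ↔ γ A = some j := by
  let π : Fin p → Finpartition (univ : Finset V) := fun j =>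
    Finpartition.ofExistsUnique (univ.filter fun E => γ E = some j) (fun _ _ => subset_univ _)
      (fun v _ => by simpa using hγ j v) (by simpa using hempty j)
  have hπ : ∀ j A, A ∈ (π j).parts ↔ γ A = some j := fun j A => by
    simp [π, Finpartition.ofExistsUnique]
  refine ⟨⟨π, fun i j hij => ?_⟩, hπ⟩
  obtain ⟨v⟩ := ‹Nonempty V›
  obtain ⟨E, hE, -⟩ := hγ i v
  have h1 := (hπ i E).2 hE.1
  rw [hij, hπ, hE.1] at h1
  simpa using h1

/-! ### The admissible sets relative to the two halves. -/

/-- The intersection sizes `i` and `L - i` with the two halves of the ground set. -/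
def splitSizes (L i : ℕ) (b : Bool) : ℕ := if b then i else L - i

lemma splitSizes_injective (L : ℕ) : Function.Injective (splitSizes L) := fun i j h => by
  simpa [splitSizes] using congrFun h true

lemma choose_mul_choose_le_count {V : Type*} [Fintype V] [DecidableEq V] (q : V → Bool)
    (τ : Bool → ℕ) :
    (#{v | q v = true}).choose (τ true) * (#{v | q v = false}).choose (τ false)
      ≤ ((univ : Finset (Finset V)).val.map (intersectionSizes q)).count τ := by
  rw [Multiset.count_map, ← filter_val, ← card_def, ← card_powersetCard, ← card_powersetCard,
    ← card_product]
  refine card_le_card_of_injOn (fun A => A.1 ∪ A.2) ?_ ?_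
  · rintro ⟨A, B⟩ h
    simp only [coe_product, Set.mem_prod, mem_coe, mem_powersetCard, subset_iff, mem_filter,
      mem_univ, true_and] at h
    simp only [coe_filter, mem_univ, true_and, Set.mem_ofPred_eq]
    funext b
    rw [intersectionSizes]
    cases b
    · rw [← h.2.2]; congr 1; ext v; simp only [mem_filter, mem_union]; grind
    · rw [← h.1.2]; congr 1; ext v; simp only [mem_filter, mem_union]; grind
  · rintro ⟨A, B⟩ h ⟨A', B'⟩ h' heq
    simp only [coe_product, Set.mem_prod, mem_coe, mem_powersetCard, subset_iff, mem_filter,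
      mem_univ, true_and] at h h'
    simp only [Finset.ext_iff, mem_union] at heq
    refine Prod.ext ?_ ?_
    · ext v; have := heq v; grind
    · ext v; have := heq v; grind

/-- The numbers of elements that a large set may have in the first half. -/
def outerIndices (c u : ℕ) : Finset ℕ := range u ∪ Icc (c + 2 - u) (c + 1)

lemma mem_outerIndices {c u i : ℕ} :
    i ∈ outerIndices c u ↔ i < u ∨ (c + 2 - u ≤ i ∧ i ≤ c + 1) := by
  simp [outerIndices]

lemma sum_outerIndices {n c u : ℕ} (hu : u ≤ c / 2) :
    ∑ i ∈ outerIndices c u, splitCount (n / 2) (c + 1) i = b n c u := by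
  rw [outerIndices, sum_union, b, two_mul]
  · congr 1
    refine sum_nbij' (c + 1 - ·) (c + 1 - ·) ?_ ?_ ?_ ?_ ?_ <;>
      simp only [mem_Icc, mem_range]
    · intros; omega
    · intros; omega
    · intros; omega
    · intros; omega
    · intro i hi
      rw [← splitCount_symm (by omega)]
      rfl
  · rw [disjoint_left]
    intro i
    simp only [mem_range, mem_Icc]
    omega

/-- The admissible pairs of intersection sizes with the two halves. -/
def admissibleSizes (c u : ℕ) : Finset (Bool → ℕ) :=
  (Icc u (c - u)).image (splitSizes c) ∪ (outerIndices c u).image (splitSizes (c + 1))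

/-- Sizes exclude everything except a small set inside a large one. There the large set has fewer
than `u` points in some half, while the small set has at least `u` in both. -/
lemma not_subset_of_admissible {V : Type*} [DecidableEq V] {q : V → Bool} {c u : ℕ}
    (hu : u ≤ c / 2) {A B : Finset V} (hA : intersectionSizes q A ∈ admissibleSizes c u)
    (hB : intersectionSizes q B ∈ admissibleSizes c u) (hAB : A ≠ B) : ¬ A ⊆ B := by
  intro hsub
  have hle : ∀ b, intersectionSizes q A b ≤ intersectionSizes q B b := fun b =>
    card_le_card (filter_subset_filter _ hsub)
  have hcard : ∀ E : Finset V, #E = intersectionSizes q E true + intersectionSizes q E false := by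
    intro E
    rw [← card_filter_add_card_filter_not (fun v => q v = true)]
    simp [intersectionSizes]
  have hlt := card_lt_card (hsub.ssubset_of_ne hAB)
  rw [hcard, hcard] at hlt
  have h1 := hle true
  have h2 := hle false
  simp only [admissibleSizes, mem_union, mem_image, mem_outerIndices, mem_Icc] at hA hB
  rcases hA with ⟨i, hi, hA⟩ | ⟨i, hi, hA⟩ <;> rcases hB with ⟨i', hi', hB⟩ | ⟨i', hi', hB⟩ <;>
    rw [← hA, ← hB] at hlt h1 h2 <;> simp only [splitSizes] at hlt h1 h2 <;> simp at hlt h1 h2 <;>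
    omega

lemma card_of_admissible {V : Type*} [DecidableEq V] {q : V → Bool} {c u : ℕ}
    (hu : u ≤ c / 2) {A : Finset V} (hA : intersectionSizes q A ∈ admissibleSizes c u) : #A = c ∨ #A = c + 1 := by
  have hcard : #A = intersectionSizes q A true + intersectionSizes q A false := by
    rw [← card_filter_add_card_filter_not (fun v => q v = true)]
    simp [intersectionSizes]
  rw [hcard]
  simp only [admissibleSizes, mem_union, mem_image, mem_outerIndices, mem_Icc] at hA
  rcases hA with ⟨i, hi, hA⟩ | ⟨i, hi, hA⟩ <;> rw [← hA] <;> simp [splitSizes] <;> omega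

lemma weighted_admissible_le {V : Type*} [Fintype V] [DecidableEq V] {q : V → Bool} {m c u : ℕ}
    (hq : ∀ b, #{v | q v = b} = m) :
    (weighted (Icc u (c - u)) (splitCount m c)).map (splitSizes c)
      + (weighted (outerIndices c u) (splitCount m (c + 1))).map (splitSizes (c + 1))
      ≤ (univ : Finset (Finset V)).val.map (intersectionSizes q) := by
  have hinj : ∀ L S, Set.InjOn (splitSizes L) S := fun L S => (splitSizes_injective L).injOn
  let w : (Bool → ℕ) → ℕ := fun τ => m.choose (τ true) * m.choose (τ false)
  rw [map_weighted_of_injOn _ (splitCount m c) _ (hinj _ _) w fun i _ => rfl,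
    map_weighted_of_injOn _ (splitCount m (c + 1)) _ (hinj _ _) w fun i _ => rfl, weighted, weighted, ← sum_union]
  · change weighted _ w ≤ _
    rw [Multiset.le_iff_count]
    intro τ
    rw [count_weighted]
    split_ifs
    · have := choose_mul_choose_le_count q τ
      rwa [hq, hq] at this
    · exact Nat.zero_le _
  · rw [disjoint_left]
    intro τ hτ hτ'
    simp only [mem_image, mem_outerIndices, mem_Icc] at hτ hτ'
    obtain ⟨i, hi, rfl⟩ := hτ
    obtain ⟨j, hj, hτ⟩ := hτ'
    have h1 := congrFun hτ true
    have h2 := congrFun hτ false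
    simp [splitSizes] at h1 h2
    omega

lemma sum_map_splitSizes {L s : ℕ} {B : Multiset ℕ} (hB : IsCentred L s B) (hL : ∀ i ∈ B, i ≤ L)
    (b : Bool) : 2 * ((B.map (splitSizes L)).map fun τ => τ b).sum = s * L := by
  rw [Multiset.map_map]
  have htrue : (B.map ((fun τ : Bool → ℕ => τ true) ∘ splitSizes L)).sum = B.sum := by
    congr 1
    exact (Multiset.map_congr rfl fun i _ => rfl).trans (Multiset.map_id B)
  cases b
  · have hadd : (B.map ((fun τ : Bool → ℕ => τ false) ∘ splitSizes L)).sum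
        + (B.map ((fun τ : Bool → ℕ => τ true) ∘ splitSizes L)).sum = s * L := by
      rw [← Multiset.sum_map_add, ← hB.1, ← smul_eq_mul, ← Multiset.sum_replicate,
        ← Multiset.map_const']
      congr 1
      refine Multiset.map_congr rfl fun i hi => ?_
      have := hL i hi
      simp [splitSizes]
      omega
    rw [htrue] at hadd
    have := hB.2
    omega
  · rw [htrue, hB.2]

/-! ### Groups for the given parameters and the final assembly. -/

lemma packs_small {m k c r u p : ℕ} (hk : 3 ≤ k)
    (hcr : 2 * m = c * k + r) (hrk : r < k) (hr : r ≠ 0) (hck_even : Even (c * k))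
    (hu_pos : 1 ≤ u) (hu_le : u ≤ c / 2) (hu : r = k - 1 → 2 * u = c)
    (hp : (k - r) * p ≤ ∑ i ∈ Icc u (c - u), splitCount m c i) :
    Packs (IsCentred c (k - r)) p (weighted (Icc u (c - u)) (splitCount m c)) := by
  rcases Nat.even_or_odd (k - r) with hs | hs
  · refine packs_of_even hs _ _ (fun i hi => ?_) (fun i hi => ?_) hp
    · rw [mem_Icc] at hi ⊢; omega
    · rw [mem_Icc] at hi; exact splitCount_symm (by omega)
  · have hr_even : Even r := (Nat.even_add.1 (hcr ▸ even_two_mul m)).1 hck_even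
    have hk_odd : ¬ Even k := fun hk' => by
      rw [Nat.odd_iff] at hs; rw [Nat.even_iff] at hr_even hk'; omega
    obtain ⟨g, hg⟩ := (Nat.even_mul.1 hck_even).resolve_right hk_odd
    obtain rfl : c = 2 * g := by omega
    by_cases hs1 : k - r = 1
    · have hug := hu (by omega)
      rw [show 2 * g - u = u by omega, Icc_self] at hp ⊢
      rw [sum_singleton, hs1, one_mul] at hp
      rw [hs1, weighted, sum_singleton]
      have h := (Packs.single (good := IsCentred (2 * g) 1) (A := {u})
        ⟨rfl, by simp; omega⟩).nsmul (splitCount m (2 * g) u)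
      rw [mul_one] at h
      exact h.of_le hp
    -- Here `k - r ≥ 3` and `r ≥ 2`. Then `2 * m ≥ 5 * c = 10 * g`, the size bound behind the gap at
    -- the peak.
    · have hk5 : 5 ≤ k := by
        rw [Nat.odd_iff] at hs; rw [Nat.even_iff] at hr_even; omega
      refine packs_of_odd hs (by rw [Nat.odd_iff] at hs; omega) hu_pos (by omega) ?_ hp
      have : 2 * g * 5 ≤ 2 * g * k := Nat.mul_le_mul_left _ hk5
      omega

lemma packs_large {m c r u p : ℕ} (hr_even : Even r) (hu_le : u ≤ c / 2)
    (hp : r * p ≤ ∑ i ∈ outerIndices c u, splitCount m (c + 1) i) :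
    Packs (IsCentred (c + 1) r) p (weighted (outerIndices c u) (splitCount m (c + 1))) := by
  refine packs_of_even hr_even _ _ (fun i hi => ?_) (fun i hi => ?_) hp
  · rw [mem_outerIndices] at hi ⊢; omega
  · rw [mem_outerIndices] at hi; exact splitCount_symm (by omega)

lemma card_filter_half {m n : ℕ} (hn : n = m + m) (b : Bool) :
    (univ.filter fun v : Fin n => decide (v.val < m) = b).card = m := by
  subst hn
  have h : (univ.filter fun v : Fin (m + m) => v.val < m).card = m := by
    rw [Fin.card_filter_val_lt]; omega
  cases b
  · have h' := card_filter_add_card_filter_not (s := (univ : Finset (Fin (m + m))))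
      (fun v => v.val < m)
    rw [card_univ, Fintype.card_fin, h] at h'
    simp only [decide_eq_false_iff_not]
    omega
  · simpa using h

end SpernerPartition

theorem mainTheorem5 (n k c r u : ℕ) (hn : 2 * k ≤ n) (hk : 3 ≤ k)
    (hcr : n = c * k + r) (hrk : r < k) (hr : r ≠ 0)
    (hn_even : Even n) (hck_even : Even (c * k))
    (hu_pos : 1 ≤ u) (hu_le : u ≤ c / 2) (hu : r = k - 1 → 2 * u = c) :
    ∃ P : Finset (Finpartition (Finset.univ : Finset (Fin n))),
      SpernerPartition.IsSpernerPartitionSystem n k P ∧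
      SpernerPartition.IsAlmostUniform n k P ∧
      P.card = min (SpernerPartition.a n c u / (k - r)) (SpernerPartition.b n c u / r) := by
  open SpernerPartition Finset in
  obtain ⟨m, hm⟩ := hn_even
  have hm2 : n / 2 = m := by omega
  set p := min (SpernerPartition.a n c u / (k - r)) (SpernerPartition.b n c u / r) with hp
  have hpa : (k - r) * p ≤ ∑ i ∈ Icc u (c - u), splitCount m c i := by
    refine (Nat.mul_le_mul_left _ (min_le_left _ _)).trans ((Nat.mul_div_le _ _).trans ?_)
    rw [← hm2]; rfl
  have hpb : r * p ≤ ∑ i ∈ outerIndices c u, splitCount m (c + 1) i := by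
    refine (Nat.mul_le_mul_left _ (min_le_right _ _)).trans ((Nat.mul_div_le _ _).trans ?_)
    rw [← hm2, sum_outerIndices hu_le]
  have hr_even : Even r := (Nat.even_add.1 (hcr ▸ ⟨m, hm⟩)).1 hck_even
  obtain ⟨G, hG, hGle⟩ := packs_small (m := m) hk (by omega) hrk hr hck_even hu_pos hu_le hu hpa
  obtain ⟨G', hG', hGle'⟩ := packs_large hr_even hu_le hpb
  have hmemG : ∀ j, ∀ i ∈ G j, i ≤ c := fun j i hi => by
    have := mem_of_mem_weighted _ _
      (Multiset.mem_of_le ((single_le_sum (fun _ _ => zero_le) (mem_univ j)).trans hGle) hi)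
    rw [mem_Icc] at this
    omega
  have hmemG' : ∀ j, ∀ i ∈ G' j, i ≤ c + 1 := fun j i hi => by
    have := mem_of_mem_weighted _ _
      (Multiset.mem_of_le ((single_le_sum (fun _ _ => zero_le) (mem_univ j)).trans hGle') hi)
    rw [mem_outerIndices] at this
    omega
  let q : Fin n → Bool := fun v => decide (v.val < m)
  have hq : ∀ b, #{v | q v = b} = m := card_filter_half hm
  let H : Fin p → Multiset (Bool → ℕ) :=
    fun j => (G j).map (splitSizes c) + (G' j).map (splitSizes (c + 1))
  have hHle : ∑ j, H j ≤ (weighted (Icc u (c - u)) (splitCount m c)).map (splitSizes c)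
      + (weighted (outerIndices c u) (splitCount m (c + 1))).map (splitSizes (c + 1)) := by
    simp only [H]
    rw [sum_add_distrib]
    have hmap : ∀ (f : ℕ → Bool → ℕ) (G : Fin p → Multiset ℕ),
        ∑ j, (G j).map f = (∑ j, G j).map f := fun f G => by
      rw [← Multiset.coe_mapAddMonoidHom, map_sum]
    rw [hmap, hmap]
    exact add_le_add (Multiset.map_le_map hGle) (Multiset.map_le_map hGle')
  have hcard : ∀ j, (H j).card = k := fun j => by
    simp only [H, Multiset.card_add, Multiset.card_map, (hG j).1, (hG' j).1]
    omega
  obtain ⟨γ, hprof, huniq⟩ := exists_partition_colouring q H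
    (hHle.trans (weighted_admissible_le hq)) (fun j b => by
      rw [hq]
      have h1 := sum_map_splitSizes (hG j) (hmemG j) b
      have h2 := sum_map_splitSizes (hG' j) (hmemG' j) b
      simp only [H, Multiset.map_add, Multiset.sum_add]
      -- Twice the total on either half is this sum, so each half is covered with total `m`.
      have h3 : (k - r) * c + r * (c + 1) = n := by
        obtain ⟨s, rfl⟩ := Nat.exists_eq_add_of_le hrk.le
        rw [Nat.add_sub_cancel_left, hcr]
        ring
      omega)
  have hadm : ∀ j A, γ A = some j → intersectionSizes q A ∈ admissibleSizes c u := by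
    intro j A hA
    have h1 : intersectionSizes q A ∈ H j := by
      rw [← hprof j]
      exact Multiset.mem_map_of_mem _ (by simpa using hA)
    have h2 := Multiset.mem_of_le
      ((single_le_sum (fun _ _ => zero_le) (mem_univ j)).trans hHle) h1
    rw [Multiset.mem_add, Multiset.mem_map, Multiset.mem_map] at h2
    rw [admissibleSizes, mem_union, mem_image, mem_image]
    refine h2.imp ?_ ?_
    · rintro ⟨i, hi, h⟩; exact ⟨i, mem_of_mem_weighted _ _ hi, h⟩
    · rintro ⟨i, hi, h⟩; exact ⟨i, mem_of_mem_weighted _ _ hi, h⟩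
  have hempty : ∀ j, γ ∅ ≠ some j := fun j h => by
    have := card_of_admissible hu_le (hadm j ∅ h)
    rw [card_empty] at this
    omega
  have : Nonempty (Fin n) := ⟨⟨0, by omega⟩⟩
  obtain ⟨π, hπ⟩ := exists_finpartition_family γ huniq hempty
  have hnk : n / k = c := by
    rw [hcr, mul_comm, Nat.mul_add_div (by omega), Nat.div_eq_of_lt hrk, add_zero]
  have hnk' : n ⌈/⌉ k = c + 1 := by
    rw [Nat.ceilDiv_eq_add_pred_div, hcr,
      show c * k + r + k - 1 = k * (c + 1) + (r - 1) by rw [mul_add, mul_comm]; omega,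
      Nat.mul_add_div (by omega), Nat.div_eq_of_lt (by omega), add_zero]
  refine ⟨univ.map π, ⟨Fintype.card_fin n, ?_, ?_⟩, ?_, ?_⟩
  · intro ρ hρ
    obtain ⟨j, -, rfl⟩ := mem_map.1 hρ
    have : (π j).parts = univ.filter fun E => γ E = some j := by ext A; simp [hπ]
    rw [this, card_def, ← Multiset.card_map (intersectionSizes q), hprof, hcard]
  · intro ρ hρ ρ' hρ' hne A hA B hB
    obtain ⟨j, -, rfl⟩ := mem_map.1 hρ
    obtain ⟨j', -, rfl⟩ := mem_map.1 hρ'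
    rw [hπ] at hA hB
    refine not_subset_of_admissible hu_le (hadm j A hA) (hadm j' B hB) ?_
    rintro rfl
    rw [hA] at hB
    exact hne (by rw [Option.some_injective _ hB])
  · intro ρ hρ A hA
    obtain ⟨j, -, rfl⟩ := mem_map.1 hρ
    rw [hπ] at hA
    rw [hnk, hnk']
    exact card_of_admissible hu_le (hadm j A hA)
  · rw [card_map, card_univ, Fintype.card_fin]
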